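/- All vector spaces are over $\mathbb{C}$. A vertex operator superalgebra is a quadruple $(V,Y,\mathbf 1,\omega)$ with $V=\bigoplus_{q\in\frac12\mathbb Z}V_{(q)}$, where $V_{(q)}=\{v\in V: L(0)v=qv\}$ is finite-dimensional and is zero for $q$ sufficiently negative; the even (resp. odd) part of $V$ is the sum of the $V_{(q)}$ with $q\in\mathbb Z$ (resp. $q\in\frac12+\mathbb Z$), and $\mathbf 1,\omega$ are even. The linear map $v\mapsto Y(v,z)=\sum_{n\in\mathbb Z}v_nz^{-n-1}$, $v_n\in\operatorname{End}V$, respects parity, satisfies $u_nv=0$ for $n$ sufficiently large, the super Jacobi identity and the vacuum and creation axioms; the operators $L(n)=\omega_{n+1}$ satisfy the Virasoro relations for some central charge $c_V\in\mathbb C$; and $Y(L(-1)v,z)=\frac{d}{dz}Y(v,z)$. It is simple if $V\neq0$ and its only ideals (subspaces $I$ with $v_nI\subset I$ and $x_nV\subset I$ for all $v\in V$, $x\in I$, $n\in\mathbb Z$) are $0$ and $V$. It is strongly generated by a subset $T$ if $V$ is linearly spanned by $\mathbf 1$ and the vectors $a^{(1)}_{-n_1}\cdots a^{(r)}_{-n_r}\mathbf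 1$ with $r\ge1$, $a^{(i)}\in T$ and integers $n_i\ge1$. Let $V$ be a simple vertex operator superalgebra which is strongly generated by $V_{(3/2)}+V_{(2)}$. Then there are a unique bilinear form $\langle\cdot,\cdot\rangle$ on $V_{(2)}$ and a unique bilinear form $\langle\cdot,\cdot\rangle$ on $V_{(3/2)}$, both $\mathbb C$-valued, such that $$a_3b=\langle a,b\rangle\mathbf 1\quad(a,b\in V_{(2)}),\qquad u_2v=\langle u,v\rangle\mathbf 1\quad(u,v\in V_{(3/2)}),$$ and both of these bilinear forms are non-degenerate. -/

import Mathlib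

/-- The data underlying a vertex operator superalgebra: the state-field map `Y` (each `Y u` maps
`v` to a Laurent series, so that `u_n v = 0` for `n` sufficiently large), the vacuum vector and
the conformal vector. -/
structure VertexSuperData (V : Type*) [AddCommGroup V] [Module ℂ V] where
  /-- the state-field correspondence -/
  Y : V →ₗ[ℂ] VertexOperator ℂ V
  /-- the vacuum vector -/
  vacuum : V
  /-- the conformal vector -/
  conformal : V

namespace VertexSuperData

variable {V : Type*} [AddCommGroup V] [Module ℂ V]

/-- The operator `u_n`, the coefficient of `z^(-n-1)` in `Y(u,z)`. -/
noncomputable def mode (D : VertexSuperData V) (u : V) (n : ℤ) : Module.End ℂ V :=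
  VertexOperator.ncoeff (D.Y u) n

/-- `L(n) = ω_{n+1}`. -/
noncomputable def L (D : VertexSuperData V) (n : ℤ) : Module.End ℂ V :=
  D.mode D.conformal (n + 1)

/-- `V_(q) = {v | L(0) v = q v}`. -/
noncomputable def weightSpace (D : VertexSuperData V) (q : ℚ) : Submodule ℂ V :=
  Module.End.eigenspace (D.L 0) (q : ℂ)

/-- The even part (`α = 0`, sum of the `V_(n)`) and the odd part (`α = 1`, sum of the
`V_(n+1/2)`), `n` ranging over the integers. -/
noncomputable def parityPart (D : VertexSuperData V) (α : ZMod 2) : Submodule ℂ V :=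
  ⨆ (k : ℤ) (_ : (k : ZMod 2) = α), D.weightSpace ((k : ℚ) / 2)

/-- `V` is linearly spanned by the vectors `a¹_{-n₁} ⋯ aʳ_{-n_r} 𝟏` with `r ≥ 0`, `aⁱ ∈ T` and
`nᵢ ≥ 1` (the empty word, `r = 0`, being the vacuum vector). -/
def StronglyGeneratedBy (D : VertexSuperData V) (T : Set V) : Prop :=
  Submodule.span ℂ {x : V | ∃ l : List (V × ℕ), (∀ p ∈ l, p.1 ∈ T ∧ 1 ≤ p.2) ∧
    x = l.foldr (fun p w => D.mode p.1 (-(p.2 : ℤ)) w) D.vacuum} = ⊤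

/-- A (two-sided) ideal. -/
structure IsIdeal (D : VertexSuperData V) (I : Submodule ℂ V) : Prop where
  mode_mem : ∀ (v : V) (n : ℤ), ∀ x ∈ I, D.mode v n x ∈ I
  mem_mode : ∀ x ∈ I, ∀ (n : ℤ) (v : V), D.mode x n v ∈ I

/-- `V` is nonzero and has no ideals other than `0` and `V`. -/
def IsSimple (D : VertexSuperData V) : Prop :=
  Nontrivial V ∧ ∀ I : Submodule ℂ V, D.IsIdeal I → I = ⊥ ∨ I = ⊤

/-- The bilinear form `B` on `V_(q)` is the one determined by `u_n v = B(u,v) 𝟏`. -/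
def IsFormOfMode (D : VertexSuperData V) (q : ℚ) (n : ℤ)
    (B : LinearMap.BilinForm ℂ (D.weightSpace q)) : Prop :=
  ∀ u v : D.weightSpace q, D.mode (u : V) n (v : V) = B u v • D.vacuum

end VertexSuperData

/-- A vertex operator superalgebra, graded by conformal weights in `½ℤ`, whose even (odd) part is
the sum of the weight spaces of integral (half-integral) weight. -/
structure VertexOperatorSuperalgebra (V : Type*) [AddCommGroup V] [Module ℂ V] extends
    VertexSuperData V where
  isInternal : DirectSum.IsInternal fun k : ℤ => toVertexSuperData.weightSpace ((k : ℚ) / 2)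
  finiteDimensional : ∀ k : ℤ,
    FiniteDimensional ℂ (toVertexSuperData.weightSpace ((k : ℚ) / 2))
  exists_weight_bound : ∃ N : ℤ, ∀ k : ℤ, k < N →
    toVertexSuperData.weightSpace ((k : ℚ) / 2) = ⊥
  vacuum_even : vacuum ∈ toVertexSuperData.parityPart 0
  conformal_even : conformal ∈ toVertexSuperData.parityPart 0
  mode_parity : ∀ (α β : ZMod 2), ∀ u ∈ toVertexSuperData.parityPart α,
    ∀ v ∈ toVertexSuperData.parityPart β, ∀ n : ℤ,
      toVertexSuperData.mode u n v ∈ toVertexSuperData.parityPart (α + β)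
  /-- The Jacobi identity in components; by truncation all sums are finite. -/
  jacobi : ∀ (α β : ZMod 2), ∀ u ∈ toVertexSuperData.parityPart α,
    ∀ v ∈ toVertexSuperData.parityPart β, ∀ (m n k : ℤ) (w : V),
      ∑ᶠ i : ℕ, ((-1 : ℂ) ^ i * (Ring.choose m i : ℂ)) •
          (toVertexSuperData.mode u (m + k - i) (toVertexSuperData.mode v (n + i) w)
            - ((-1 : ℂ) ^ (α.val * β.val) * (-1 : ℂ) ^ m) •
              toVertexSuperData.mode v (m + n - i) (toVertexSuperData.mode u (k + i) w))
        = ∑ᶠ i : ℕ, (Ring.choose k i : ℂ) •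
            toVertexSuperData.mode (toVertexSuperData.mode u (m + i) v) (n + k - i) w
  vacuum_mode : ∀ (m : ℤ) (v : V),
    toVertexSuperData.mode vacuum m v = if m = -1 then v else 0
  mode_neg_one_vacuum : ∀ v : V, toVertexSuperData.mode v (-1) vacuum = v
  mode_natCast_vacuum : ∀ (v : V) (n : ℕ), toVertexSuperData.mode v (n : ℤ) vacuum = 0
  centralCharge : ℂ
  virasoro : ∀ (m n : ℤ) (w : V),
    toVertexSuperData.L m (toVertexSuperData.L n w)
        - toVertexSuperData.L n (toVertexSuperData.L m w)
      = ((m : ℂ) - (n : ℂ)) • toVertexSuperData.L (m + n) w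
        + (if m + n = 0 then ((m : ℂ) ^ 3 - (m : ℂ)) / 12 * centralCharge else 0) • w
  /-- `Y(L(-1)v, z) = d/dz Y(v, z)`. -/
  mode_L_neg_one : ∀ (v : V) (n : ℤ) (w : V),
    toVertexSuperData.mode (toVertexSuperData.L (-1) v) n w
      = (-(n : ℂ)) • toVertexSuperData.mode v (n - 1) w

/-! Modes `t_{-n}`, `n ≥ 1`, raise weight by at least wt `t`, so strong generation in weights 3/2
and 2 leaves only `ℂ𝟏` in weight 0 and nothing else below 3/2 (`hasWeightGap_of_stronglyGenerated`).
Hence the products in question are multiples of `𝟏`, which gives the forms and their uniqueness. Let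
`a` be in the left radical. As there is nothing in weights 1/2 and 1, commuting with `L(1)` gives
`a_n v = 0` for every homogeneous `v` with `a_n v` of weight 0 (`HasWeightGap.mode_eq_zero`), and
skew symmetry gives `v_n a = 0`. So the ideal generated by `a`, spanned by the vectors `v_n a`,
misses `𝟏`; by simplicity `a = 0` (`eq_zero_of_orbit`). Skew symmetry reduces the right radical to
the left one. -/

namespace VertexSuperData

variable {V : Type*} [AddCommGroup V] [Module ℂ V] (D : VertexSuperData V)

/-- The `n`-th product `u_n v`, linear in both arguments. -/
noncomputable def modeHom (n : ℤ) : V →ₗ[ℂ] Module.End ℂ V :=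
  (LinearMap.proj n).comp (VertexOperator.ncoeff.comp D.Y)

theorem mode_add (u v : V) (n : ℤ) : D.mode (u + v) n = D.mode u n + D.mode v n :=
  (D.modeHom n).map_add u v

theorem mode_smul (c : ℂ) (u : V) (n : ℤ) : D.mode (c • u) n = c • D.mode u n :=
  (D.modeHom n).map_smul c u

theorem mode_zero (n : ℤ) : D.mode 0 n = 0 := (D.modeHom n).map_zero

theorem exists_mode_eq_zero (u w : V) : ∃ N : ℤ, ∀ n, N ≤ n → D.mode u n w = 0 :=
  ⟨-HahnSeries.order ((HahnModule.of ℂ).symm (D.Y u w)), fun n hn =>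
    VertexOperator.ncoeff_eq_zero_of_lt_order _ _ _ (by omega)⟩

theorem mem_weightSpace {q : ℚ} {v : V} : v ∈ D.weightSpace q ↔ D.L 0 v = (q : ℂ) • v :=
  Module.End.mem_eigenspace_iff

theorem weightSpace_le_parityPart (k : ℤ) :
    D.weightSpace ((k : ℚ) / 2) ≤ D.parityPart (k : ZMod 2) :=
  le_iSup₂_of_le k rfl le_rfl

end VertexSuperData

namespace VertexOperatorSuperalgebra

variable {V : Type*} [AddCommGroup V] [Module ℂ V] (S : VertexOperatorSuperalgebra V)

/-! ### Commutators with `L(0)` and `L(1)`, the grading, skew symmetry. -/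

/-- The supercommutator formula. -/
theorem supercommutator {u v : V} {α β : ZMod 2} (hu : u ∈ S.parityPart α)
    (hv : v ∈ S.parityPart β) (k n : ℤ) (w : V) :
    S.mode u k (S.mode v n w) - (-1 : ℂ) ^ (α.val * β.val) • S.mode v n (S.mode u k w)
      = ∑ᶠ i : ℕ, (Ring.choose (k : ℂ) i) • S.mode (S.mode u i v) (n + k - i) w := by
  have h := S.jacobi α β u hu v hv 0 n k w
  rw [finsum_eq_single _ 0] at h
  · simpa using h
  · intro i hi
    simp [Ring.choose_zero_pos ℂ (Nat.pos_of_ne_zero hi)]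

/-- The commutator formula for an even vector. -/
theorem commutator_of_even {u v : V} {β : ZMod 2} (hu : u ∈ S.parityPart 0)
    (hv : v ∈ S.parityPart β) (k n : ℤ) (w : V) :
    S.mode u k (S.mode v n w) - S.mode v n (S.mode u k w)
      = ∑ᶠ i : ℕ, (Ring.choose (k : ℂ) i) • S.mode (S.mode u i v) (n + k - i) w := by
  simpa using S.supercommutator hu hv k n w

theorem L_zero_mode {v : V} {β : ZMod 2} (hv : v ∈ S.parityPart β) (n : ℤ) (w : V) :
    S.L 0 (S.mode v n w) = S.mode v n (S.L 0 w) + S.mode (S.L 0 v) n w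
      - ((n : ℂ) + 1) • S.mode v n w := by
  have h := S.commutator_of_even S.conformal_even hv 1 n w
  have h1 : ∀ i : ℕ, Ring.choose ((1 : ℤ) : ℂ) i = (Nat.choose 1 i : ℂ) := fun i => by
    rw [← Ring.choose_natCast]; simp
  simp only [h1] at h
  rw [finsum_eq_sum_of_support_subset (s := Finset.range 2)] at h
  · have h2 := S.mode_L_neg_one v (n + 1) w
    simp only [Finset.sum_range_succ, Finset.sum_range_zero, VertexSuperData.L] at h h2 ⊢
    simp only [Nat.choose_zero_right, Nat.choose_self, Nat.cast_zero, Nat.cast_one, one_smul,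
      zero_add, sub_zero, neg_add_cancel, add_sub_cancel_right] at h h2 ⊢
    rw [sub_eq_iff_eq_add] at h
    rw [h, h2]
    push_cast
    module
  · intro i hi
    by_contra hc
    simp only [Finset.coe_range, Set.mem_Iio, not_lt] at hc
    simp [Nat.choose_eq_zero_of_lt (show 1 < i by omega)] at hi

theorem L_one_mode {v : V} {β : ZMod 2} (hv : v ∈ S.parityPart β) (n : ℤ) (w : V) :
    S.L 1 (S.mode v n w) = S.mode v n (S.L 1 w) + S.mode (S.L 1 v) n w
      + (2 : ℂ) • S.mode (S.L 0 v) (n + 1) w - ((n : ℂ) + 2) • S.mode v (n + 1) w := by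
  have h := S.commutator_of_even S.conformal_even hv 2 n w
  have h1 : ∀ i : ℕ, Ring.choose ((2 : ℤ) : ℂ) i = (Nat.choose 2 i : ℂ) := fun i => by
    rw [← Ring.choose_natCast]; simp
  simp only [h1] at h
  rw [finsum_eq_sum_of_support_subset (s := Finset.range 3)] at h
  · have h2 := S.mode_L_neg_one v (n + 2) w
    simp only [Finset.sum_range_succ, Finset.sum_range_zero, VertexSuperData.L] at h h2 ⊢
    simp only [Nat.choose_zero_right, Nat.choose_self, Nat.choose_one_right, Nat.cast_zero,
      Nat.cast_one, Nat.cast_ofNat, one_smul, zero_add, sub_zero, neg_add_cancel,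
      add_sub_cancel_right, one_add_one_eq_two, show n + 2 - 1 = n + 1 by ring] at h h2 ⊢
    rw [sub_eq_iff_eq_add] at h
    rw [h, h2]
    push_cast
    module
  · intro i hi
    by_contra hc
    simp only [Finset.coe_range, Set.mem_Iio, not_lt] at hc
    simp [Nat.choose_eq_zero_of_lt (show 2 < i by omega)] at hi

/-- `u_n` shifts weights by `wt u - n - 1`; weights are written as halves of integers. -/
theorem mode_mem_weightSpace {j k l n : ℤ} (hl : l = j + k - 2 * n - 2) {u v : V}
    (hu : u ∈ S.weightSpace ((j : ℚ) / 2)) (hv : v ∈ S.weightSpace ((k : ℚ) / 2)) :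
    S.mode u n v ∈ S.weightSpace ((l : ℚ) / 2) := by
  have h := S.L_zero_mode (S.weightSpace_le_parityPart j hu) n v
  rw [VertexSuperData.mem_weightSpace] at *
  rw [h, hu, hv, S.mode_smul, hl]
  simp only [map_smul, LinearMap.smul_apply]
  push_cast
  module

theorem L_one_mem_weightSpace {k l : ℤ} (hl : l = k - 2) {v : V}
    (hv : v ∈ S.weightSpace ((k : ℚ) / 2)) : S.L 1 v ∈ S.weightSpace ((l : ℚ) / 2) := by
  have h := S.virasoro 0 1 v
  rw [VertexSuperData.mem_weightSpace] at *
  rw [hv] at h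
  simp only [Int.cast_zero, Int.cast_one, zero_sub, zero_add, map_smul, neg_smul, one_smul,
    one_ne_zero, if_false, zero_smul, add_zero] at h
  rw [sub_eq_iff_eq_add] at h
  rw [h, hl]
  push_cast
  module

theorem vacuum_mem_weightSpace : S.vacuum ∈ S.weightSpace (((0 : ℤ) : ℚ) / 2) := by
  rw [VertexSuperData.mem_weightSpace]
  simpa [VertexSuperData.L] using S.mode_natCast_vacuum S.conformal 1

/-- Skew symmetry, in the case that `u_{m+1+i} v` vanishes for `i ≥ 0`. -/
theorem skew_symmetry {u v : V} {α β : ZMod 2} (hu : u ∈ S.parityPart α)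
    (hv : v ∈ S.parityPart β) {m : ℤ} (h0 : ∀ i : ℕ, S.mode u (m + 1 + i) v = 0) :
    S.mode u m v = ((-1 : ℂ) ^ (α.val * β.val) * (-1 : ℂ) ^ (m + 1)) • S.mode v m u := by
  -- On the vacuum only `i = 0` survives on the left, leaving `u_m v` and `v_m u`; `h0` kills the
  -- right side.
  have h := S.jacobi α β u hu v hv (m + 1) (-1) (-1) S.vacuum
  rw [finsum_eq_single _ 0] at h
  · simpa [h0, S.mode_neg_one_vacuum, S.mode_zero, sub_eq_zero] using h
  · intro i hi
    obtain ⟨j, rfl⟩ := Nat.exists_eq_succ_of_ne_zero hi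
    simp [S.mode_natCast_vacuum]

theorem iSup_weightSpace : ⨆ k : ℤ, S.weightSpace ((k : ℚ) / 2) = ⊤ :=
  S.isInternal.submodule_iSup_eq_top

/-- An induction principle: linear statements may be checked on vectors of pure weight. -/
theorem weight_induction {p : V → Prop} (hom : ∀ (k : ℤ), ∀ v ∈ S.weightSpace ((k : ℚ) / 2), p v)
    (zero : p 0) (add : ∀ u v, p u → p v → p (u + v)) (v : V) : p v :=
  Submodule.iSup_induction _ (motive := p)
    (show v ∈ ⨆ k : ℤ, S.weightSpace ((k : ℚ) / 2) from S.iSup_weightSpace ▸ Submodule.mem_top)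
    hom zero add

theorem vacuum_ne_zero [Nontrivial V] : S.vacuum ≠ 0 := by
  intro h
  obtain ⟨v, hv⟩ := exists_ne (0 : V)
  exact hv (by rw [← S.mode_neg_one_vacuum v, h, map_zero])

/-! ### Ideals generated by homogeneous vectors. -/

theorem finsum_mem_submodule {ι : Type*} (I : Submodule ℂ V) {f : ι → V} (h : ∀ i, f i ∈ I) :
    ∑ᶠ i, f i ∈ I :=
  finsum_induction (· ∈ I) I.zero_mem (fun _ _ => I.add_mem) h

/-- Up to the factor `d!`, `x_{-1-d} 𝟏` is `L(-1)^d x`, and `L(-1) = ω_0` preserves `I`. -/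
theorem mode_vacuum_mem {I : Submodule ℂ V} (hI : ∀ (v : V) (n : ℤ), ∀ x ∈ I, S.mode v n x ∈ I)
    {x : V} (hx : x ∈ I) (n : ℤ) : S.mode x n S.vacuum ∈ I := by
  rcases le_or_gt 0 n with hn | hn
  · obtain ⟨m, rfl⟩ := Int.eq_ofNat_of_zero_le hn
    simp [S.mode_natCast_vacuum]
  obtain ⟨d, rfl⟩ : ∃ d : ℕ, n = -1 - d := ⟨(-1 - n).toNat, by omega⟩
  clear hn
  induction d generalizing x with
  | zero => simpa [S.mode_neg_one_vacuum] using hx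
  | succ d ih =>
    have h := ih (hI S.conformal (-1 + 1) x hx)
    have h2 := S.mode_L_neg_one x (-1 - d) S.vacuum
    rw [VertexSuperData.L] at h2
    rw [h2, show (-1 - (d : ℤ) - 1) = -1 - ((d + 1 : ℕ) : ℤ) by push_cast; ring] at h
    refine (I.smul_mem_iff ?_).1 h
    have : (-((-1 - (d : ℤ) : ℤ) : ℂ)) = ((d + 1 : ℕ) : ℂ) := by push_cast; ring
    rw [this]
    exact Nat.cast_ne_zero.2 d.succ_ne_zero

/-- A left ideal spanned by vectors of pure weight is an ideal. -/
theorem isIdeal_span {s : Set V} (hs : ∀ x ∈ s, ∃ k : ℤ, x ∈ S.weightSpace ((k : ℚ) / 2))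
    (hI : ∀ (v : V) (n : ℤ), ∀ x ∈ Submodule.span ℂ s, S.mode v n x ∈ Submodule.span ℂ s) :
    S.IsIdeal (Submodule.span ℂ s) where
  mode_mem := hI
  mem_mode x hx n v := by
    induction v using S.weight_induction with
    | zero => simp
    | add u v hu hv => rw [map_add]; exact add_mem hu hv
    | hom k v hv =>
      induction hx using Submodule.span_induction with
      | zero => simp [S.mode_zero]
      | add x y _ _ hx hy => rw [S.mode_add]; exact add_mem hx hy
      | smul c x _ hx => rw [S.mode_smul]; exact Submodule.smul_mem _ _ hx
      | mem x hx =>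
        obtain ⟨l, hl⟩ := hs x hx
        have hx := Submodule.subset_span (R := ℂ) hx
        -- Since `v_{-1} 𝟏 = v`, this expresses `x_n v` up to sign through vectors `y_m 𝟏` with `y ∈
        -- I` and `v_{-1}` of such a vector.
        have h := S.supercommutator (S.weightSpace_le_parityPart k hv)
          (S.weightSpace_le_parityPart l hl) (-1) n S.vacuum
        have h1 := hI v (-1) _ (S.mode_vacuum_mem hI hx n)
        rw [S.mode_neg_one_vacuum, sub_eq_iff_eq_add, ← sub_eq_iff_eq_add'] at h
        rw [← Submodule.smul_mem_iff _ (pow_ne_zero _ (neg_ne_zero.2 (one_ne_zero (α := ℂ)))), ← h]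
        exact sub_mem h1 (finsum_mem_submodule _ fun i => Submodule.smul_mem _ _
          (S.mode_vacuum_mem hI (hI v _ x hx) _))

/-- The vectors `v_n x` with `v` of pure weight. -/
def orbit (x : V) : Set V :=
  {y | ∃ k : ℤ, ∃ v ∈ S.weightSpace ((k : ℚ) / 2), ∃ n : ℤ, y = S.mode v n x}

theorem mem_of_finsum_mem {I : Submodule ℂ V} {f : ℕ → V} {N : ℕ} (hN : ∀ i, N ≤ i → f i = 0)
    (hf : ∀ i, f (i + 1) ∈ I) (h : ∑ᶠ i, f i ∈ I) : f 0 ∈ I := by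
  rw [finsum_eq_sum_of_support_subset (s := Finset.range (N + 1)), Finset.sum_range_succ'] at h
  · exact (Submodule.add_mem_iff_right _ (sum_mem fun i _ => hf i)).1 h
  · intro i hi
    by_contra hc
    simp only [Finset.coe_range, Set.mem_Iio, not_lt] at hc
    exact hi (hN i (by omega))

/-- Weak associativity: products of two modes on `x` reduce to single modes. The induction is
downward in `n`, starting where `v_n x = 0`. -/
theorem mode_mode_mem_span_orbit {j k : ℤ} {u v : V} (hu : u ∈ S.weightSpace ((j : ℚ) / 2))
    (hv : v ∈ S.weightSpace ((k : ℚ) / 2)) (x : V) (p n : ℤ) :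
    S.mode u p (S.mode v n x) ∈ Submodule.span ℂ (S.orbit x) := by
  obtain ⟨N, hN⟩ := S.exists_mode_eq_zero v x
  obtain ⟨M, hM⟩ := S.exists_mode_eq_zero u x
  obtain ⟨d, hd⟩ : ∃ d : ℕ, N ≤ n + d := ⟨(N - n).toNat, by omega⟩
  induction d using Nat.strong_induction_on generalizing n p with
  | _ d ih =>
    rcases Nat.eq_zero_or_pos d with rfl | hpos
    · rw [hN n (by simpa using hd), map_zero]
      exact zero_mem _
    -- As `u_{M+i} x = 0`, the left side becomes `u_p v_n x` plus multiples of `u_{p-i} v_{n+i} x`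
    -- with `i ≥ 1`; the right side is a sum of single modes on `x`.
    have h := S.jacobi _ _ u (S.weightSpace_le_parityPart j hu) v
      (S.weightSpace_le_parityPart k hv) (p - M) n M x
    have hr : ∑ᶠ i : ℕ, (Ring.choose (M : ℂ) i) •
        S.mode (S.mode u (p - M + i) v) (n + M - i) x ∈ Submodule.span ℂ (S.orbit x) :=
      finsum_mem_submodule _ fun i => Submodule.smul_mem _ _ <| Submodule.subset_span
        ⟨_, _, S.mode_mem_weightSpace rfl hu hv, _, rfl⟩
    have h2 : ∀ i : ℕ, S.mode u (M + i) x = 0 := fun i => hM _ (by omega)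
    rw [← h] at hr
    simp only [h2, map_zero, smul_zero, sub_zero, sub_add_cancel] at hr
    have h0 := mem_of_finsum_mem (f := fun i : ℕ => ((-1 : ℂ) ^ i *
      Ring.choose ((p - M : ℤ) : ℂ) i) • S.mode u (p - i) (S.mode v (n + i) x)) (N := d)
      (fun i hi => by
      rw [hN (n + i) (by omega), map_zero, smul_zero]) (fun i => Submodule.smul_mem _ _ <| by
        refine ih (d - 1) (by omega) _ (n + (i + 1 : ℕ)) ?_
        omega) hr
    simpa using h0

theorem isIdeal_span_orbit {h : ℤ} {a : V} (ha : a ∈ S.weightSpace ((h : ℚ) / 2)) :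
    S.IsIdeal (Submodule.span ℂ (S.orbit a)) := by
  refine S.isIdeal_span ?_ ?_
  · rintro _ ⟨k, v, hv, n, rfl⟩
    exact ⟨_, S.mode_mem_weightSpace rfl hv ha⟩
  · intro u p x hx
    induction u using S.weight_induction with
    | zero => simp [S.mode_zero]
    | add u v hu hv => rw [S.mode_add]; exact add_mem hu hv
    | hom j u hu =>
      induction hx using Submodule.span_induction with
      | zero => simp
      | add x y _ _ hx hy => rw [map_add]; exact add_mem hx hy
      | smul c x _ hx => rw [map_smul]; exact Submodule.smul_mem _ _ hx
      | mem x hx =>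
        obtain ⟨k, v, hv, n, rfl⟩ := hx
        exact S.mode_mode_mem_span_orbit hu hv a p n

theorem mem_span_orbit (a : V) : a ∈ Submodule.span ℂ (S.orbit a) :=
  Submodule.subset_span ⟨0, S.vacuum, S.vacuum_mem_weightSpace, -1, by simp [S.vacuum_mode]⟩

/-- In a simple vertex operator superalgebra, a homogeneous vector whose orbit avoids the weight
zero space vanishes. -/
theorem eq_zero_of_orbit (hsimple : S.IsSimple) {h : ℤ} {a : V}
    (ha : a ∈ S.weightSpace ((h : ℚ) / 2))
    (h0 : ∀ k n : ℤ, k + h - 2 * n - 2 = 0 → ∀ v ∈ S.weightSpace ((k : ℚ) / 2),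
      S.mode v n a = 0) : a = 0 := by
  have := hsimple.1
  rcases hsimple.2 _ (S.isIdeal_span_orbit ha) with hI | hI
  · simpa [hI] using S.mem_span_orbit a
  have hle : Submodule.span ℂ (S.orbit a) ≤ ⨆ (k : ℤ) (_ : k ≠ 0), S.weightSpace ((k : ℚ) / 2) := by
    rw [Submodule.span_le]
    rintro _ ⟨k, v, hv, n, rfl⟩
    by_cases hk : k + h - 2 * n - 2 = 0
    · rw [h0 k n hk v hv]
      exact zero_mem _
    · exact Submodule.mem_iSup_of_mem _ (Submodule.mem_iSup_of_mem hk
        (S.mode_mem_weightSpace rfl hv ha))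
  exact absurd (Submodule.disjoint_def.1 (S.isInternal.submodule_iSupIndep 0) _
    S.vacuum_mem_weightSpace (hle (hI ▸ Submodule.mem_top))) S.vacuum_ne_zero

/-! ### The weight gap. -/

/-- The weights of the vertex operator superalgebra are `0` and at least `3/2`, and the weight zero
space is spanned by the vacuum vector. -/
structure HasWeightGap : Prop where
  eq_bot : ∀ k : ℤ, k < 3 → k ≠ 0 → S.weightSpace ((k : ℚ) / 2) = ⊥
  mem_span_vacuum : ∀ v ∈ S.weightSpace (((0 : ℤ) : ℚ) / 2), v ∈ Submodule.span ℂ {S.vacuum}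

theorem hasWeightGap_of_stronglyGenerated (hgen : S.StronglyGeneratedBy
    ((S.weightSpace (3 / 2) ⊔ S.weightSpace 2 : Submodule ℂ V) : Set V)) : S.HasWeightGap := by
  set M : Submodule ℂ V := ⨆ (k : ℤ) (_ : 3 ≤ k), S.weightSpace ((k : ℚ) / 2) with hM
  have mem_M : ∀ k : ℤ, 3 ≤ k → ∀ v ∈ S.weightSpace ((k : ℚ) / 2), v ∈ M := fun k hk v hv =>
    Submodule.mem_iSup_of_mem _ (Submodule.mem_iSup_of_mem hk hv)
  have e3 : (3 / 2 : ℚ) = ((3 : ℤ) : ℚ) / 2 := by norm_num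
  have e4 : (2 : ℚ) = ((4 : ℤ) : ℚ) / 2 := by norm_num
  have step : ∀ j : ℤ, 3 ≤ j → ∀ t ∈ S.weightSpace ((j : ℚ) / 2), ∀ n : ℕ, 1 ≤ n →
      ∀ w ∈ Submodule.span ℂ {S.vacuum} ⊔ M, S.mode t (-(n : ℤ)) w ∈ M := by
    intro j hj t ht n hn
    suffices Submodule.span ℂ {S.vacuum} ⊔ M ≤ M.comap (S.mode t (-(n : ℤ))) from fun w hw => this hw
    refine sup_le ?_ (iSup₂_le fun k hk v hv => ?_)
    · rw [Submodule.span_singleton_le_iff_mem]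
      exact mem_M _ (by omega) _ (S.mode_mem_weightSpace rfl ht S.vacuum_mem_weightSpace)
    · exact mem_M _ (by omega) _ (S.mode_mem_weightSpace rfl ht hv)
  -- The empty word is the vacuum; by `step`, every longer word lies in `M`.
  have htop : Submodule.span ℂ {S.vacuum} ⊔ M = ⊤ := by
    rw [eq_top_iff, ← hgen, Submodule.span_le]
    rintro _ ⟨l, hl, rfl⟩
    induction l with
    | nil => exact Submodule.mem_sup_left (Submodule.mem_span_singleton_self _)
    | cons p l ih =>
      have hw := ih fun q hq => hl q (List.mem_cons_of_mem _ hq)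
      obtain ⟨hp, hn⟩ := hl p List.mem_cons_self
      obtain ⟨u, hu, v, hv, huv⟩ := Submodule.mem_sup.1 hp
      rw [List.foldr_cons, ← huv, S.mode_add]
      rw [e3] at hu
      rw [e4] at hv
      exact Submodule.mem_sup_right (add_mem (step 3 le_rfl u hu _ hn _ hw)
        (step 4 (by norm_num) v hv _ hn _ hw))
  constructor
  · intro k hk hk0
    have hle : Submodule.span ℂ {S.vacuum} ⊔ M ≤
        ⨆ (j : ℤ) (_ : j ≠ k), S.weightSpace ((j : ℚ) / 2) := by
      refine sup_le ?_ (iSup₂_le fun j hj => le_iSup₂_of_le j (by omega) le_rfl)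
      rw [Submodule.span_singleton_le_iff_mem]
      exact Submodule.mem_iSup_of_mem 0 (Submodule.mem_iSup_of_mem (Ne.symm hk0)
        S.vacuum_mem_weightSpace)
    have := S.isInternal.submodule_iSupIndep k
    rw [htop, top_le_iff] at hle
    rwa [hle, disjoint_top] at this
  · intro v hv
    obtain ⟨x, hx, y, hy, rfl⟩ := Submodule.mem_sup.1 (htop ▸ Submodule.mem_top (x := v))
    have hx0 : x ∈ S.weightSpace (((0 : ℤ) : ℚ) / 2) :=
      (Submodule.span_singleton_le_iff_mem _ _).2 S.vacuum_mem_weightSpace hx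
    have hle : M ≤ ⨆ (j : ℤ) (_ : j ≠ 0), S.weightSpace ((j : ℚ) / 2) :=
      iSup₂_le fun j hj => le_iSup₂_of_le j (by omega) le_rfl
    have hy0 : y = 0 := Submodule.disjoint_def.1 (S.isInternal.submodule_iSupIndep 0) _
      ((Submodule.add_mem_iff_right _ hx0).1 hv) (hle hy)
    rwa [hy0, add_zero]

variable {S} in
theorem HasWeightGap.eq_zero (hS : S.HasWeightGap) {k : ℤ} (hk : k < 3) (hk0 : k ≠ 0) {v : V}
    (hv : v ∈ S.weightSpace ((k : ℚ) / 2)) : v = 0 := by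
  simpa [hS.eq_bot k hk hk0] using hv

/-! ### Radicals and non-degeneracy. -/

variable {S} in
/-- A homogeneous vector in the left radical of the form on its own weight space pairs trivially
with every weight space. -/
theorem HasWeightGap.mode_eq_zero (hS : S.HasWeightGap) {h : ℤ} (h3 : 3 ≤ h) (h4 : h ≤ 4)
    {a : V} (ha : a ∈ S.weightSpace ((h : ℚ) / 2))
    (hrad : ∀ b ∈ S.weightSpace ((h : ℚ) / 2), S.mode a (h - 1) b = 0)
    {k n : ℤ} (hkn : k + h - 2 * n - 2 = 0) {v : V} (hv : v ∈ S.weightSpace ((k : ℚ) / 2)) :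
    S.mode a n v = 0 := by
  obtain ⟨m, hm⟩ : ∃ m : ℕ, k < m := ⟨(k + 1).toNat, by omega⟩
  induction m generalizing k n v with
  | zero => rw [hS.eq_zero (by omega) (by omega) hv, map_zero]
  | succ m ih =>
    by_cases hkh : k = h
    · subst hkh
      obtain rfl : n = k - 1 := by omega
      exact hrad v hv
    -- `a_{n-1} v` has weight 1 and `L(1) a` weight 1/2 or 1, so both vanish; `L(1) v` falls under
    -- the induction hypothesis.
    have h1 := S.L_one_mode (S.weightSpace_le_parityPart h ha) (n - 1) v
    rw [hS.eq_zero (k := 2) (by omega) (by omega) (S.mode_mem_weightSpace (by omega) ha hv),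
      ih (k := k - 2) (by omega) (S.L_one_mem_weightSpace rfl hv) (by omega),
      hS.eq_zero (k := h - 2) (by omega) (by omega) (S.L_one_mem_weightSpace rfl ha),
      S.mem_weightSpace.1 ha, sub_add_cancel, S.mode_zero, S.mode_smul] at h1
    -- The factor is `(h - k) / 2`, nonzero because `k ≠ h`.
    have hc : ((h - n - 1 : ℤ) : ℂ) • S.mode a n v = 0 := by
      rw [map_zero] at h1
      rw [h1]
      simp only [LinearMap.smul_apply, LinearMap.zero_apply]
      push_cast
      module
    exact (smul_eq_zero.1 hc).resolve_left (Int.cast_ne_zero.2 (by omega))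

variable {S} in
theorem HasWeightGap.skew_symmetry (hS : S.HasWeightGap) {j k n : ℤ} (hn : j + k - 2 * n - 2 = 0)
    {u v : V} (hu : u ∈ S.weightSpace ((j : ℚ) / 2)) (hv : v ∈ S.weightSpace ((k : ℚ) / 2))
    (h0 : S.mode v n u = 0) : S.mode u n v = 0 := by
  rw [S.skew_symmetry (S.weightSpace_le_parityPart j hu) (S.weightSpace_le_parityPart k hv), h0,
    smul_zero]
  -- Since `u_n v` has weight 0, the higher products have negative weight.
  exact fun i => hS.eq_zero (k := -2 - 2 * i) (by omega) (by omega)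
    (S.mode_mem_weightSpace (by omega) hu hv)

variable {S} in
theorem HasWeightGap.eq_zero_of_mode_eq_zero (hS : S.HasWeightGap) (hsimple : S.IsSimple) {h : ℤ}
    (h3 : 3 ≤ h) (h4 : h ≤ 4) {a : V} (ha : a ∈ S.weightSpace ((h : ℚ) / 2))
    (hrad : ∀ b ∈ S.weightSpace ((h : ℚ) / 2), S.mode a (h - 1) b = 0) : a = 0 :=
  S.eq_zero_of_orbit hsimple ha fun _ _ hkn _ hv =>
    hS.skew_symmetry hkn hv ha (hS.mode_eq_zero h3 h4 ha hrad hkn hv)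

variable {S} in
theorem HasWeightGap.exists_form (hS : S.HasWeightGap) (hsimple : S.IsSimple) {h : ℤ}
    (h3 : 3 ≤ h) (h4 : h ≤ 4) : ∃ B : LinearMap.BilinForm ℂ (S.weightSpace ((h : ℚ) / 2)),
      S.IsFormOfMode ((h : ℚ) / 2) (h - 1) B ∧
        (∀ B', S.IsFormOfMode ((h : ℚ) / 2) (h - 1) B' → B' = B) ∧ B.Nondegenerate := by
  have := hsimple.1
  have h1 := S.vacuum_ne_zero
  -- A functional with `φ 𝟏 = 1` reads off the coefficient of the vacuum bilinearly.
  obtain ⟨φ, hφ⟩ := (LinearMap.toSpanSingleton ℂ V S.vacuum).exists_leftInverse_of_injective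
    (LinearMap.ker_toSpanSingleton ℂ h1)
  have hφ1 : φ S.vacuum = 1 := by simpa using LinearMap.congr_fun hφ 1
  let B : LinearMap.BilinForm ℂ (S.weightSpace ((h : ℚ) / 2)) :=
    ((S.modeHom (h - 1)).domRestrict₁₂ _ _).compr₂ φ
  have hB : S.IsFormOfMode ((h : ℚ) / 2) (h - 1) B := by
    intro u v
    obtain ⟨c, hc⟩ := Submodule.mem_span_singleton.1 (hS.mem_span_vacuum _
      (S.mode_mem_weightSpace (l := 0) (n := h - 1) (by omega) u.2 v.2))
    change _ = φ (S.mode u (h - 1) v) • S.vacuum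
    rw [← hc, map_smul, hφ1, smul_eq_mul, mul_one]
  refine ⟨B, hB, fun B' hB' => ?_, fun a ha => ?_, fun b hb => ?_⟩
  · ext u v
    exact smul_left_injective ℂ h1 ((hB' u v).symm.trans (hB u v))
  · exact Subtype.ext (hS.eq_zero_of_mode_eq_zero hsimple h3 h4 a.2 fun b hb => by
      rw [hB a ⟨b, hb⟩, ha, zero_smul])
  · exact Subtype.ext (hS.eq_zero_of_mode_eq_zero hsimple h3 h4 b.2 fun a ha =>
      hS.skew_symmetry (by omega) b.2 ha (by rw [hB ⟨a, ha⟩ b, hb, zero_smul]))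

end VertexOperatorSuperalgebra

theorem mainTheorem7 {V : Type*} [AddCommGroup V] [Module ℂ V]
    (S : VertexOperatorSuperalgebra V)
    (hsimple : S.IsSimple)
    (hgen : S.StronglyGeneratedBy
      ((S.weightSpace (3 / 2) ⊔ S.weightSpace 2 : Submodule ℂ V) : Set V)) :
    (∃ B : LinearMap.BilinForm ℂ (S.weightSpace 2),
      S.IsFormOfMode 2 3 B ∧ (∀ B', S.IsFormOfMode 2 3 B' → B' = B) ∧ B.Nondegenerate) ∧
    (∃ B : LinearMap.BilinForm ℂ (S.weightSpace (3 / 2)),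
      S.IsFormOfMode (3 / 2) 2 B ∧ (∀ B', S.IsFormOfMode (3 / 2) 2 B' → B' = B) ∧
        B.Nondegenerate) := by
  have hS := S.hasWeightGap_of_stronglyGenerated hgen
  have e3 : ((3 : ℤ) : ℚ) / 2 = 3 / 2 := by norm_num
  have e4 : ((4 : ℤ) : ℚ) / 2 = 2 := by norm_num
  have h3 := hS.exists_form hsimple (h := 3) le_rfl (by norm_num)
  have h4 := hS.exists_form hsimple (h := 4) (by norm_num) le_rfl
  rw [e3] at h3
  rw [e4] at h4
  exact ⟨h4, h3⟩
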